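/- Let $K$ be a field, let $G$ be a connected simple graph on $[n]=\{1,\dots,n\}$, let $R=K[x_1,\dots,x_n,y_1,\dots,y_n]$, and let $$\mathcal{J}_G=(x_iy_j-x_jy_i : \{i,j\}\text{ an edge of }G)\subseteq R$$ be the binomial edge ideal of $G$. For $S\subseteq[n]$ let $c(S)$ denote the number of connected components of $G\setminus S$. For real $t\ge 0$, call $G$ $t$-tough if $t\cdot c(S)\le |S|$ for every $S\neq\varnothing$ with $c(S)\ge 2$, and let the toughness $\tau(G)$ be the largest $t$ for which $G$ is $t$-tough (with $\tau(G)=\infty$ if $G$ is $t$-tough for all $t$). A Noetherian ring $T$ satisfies Serre's condition $S_2$ if $\operatorname{depth}(T_{\mathfrak p})\ge\min\{2,\dim T_{\mathfrak p}\}$ for every prime ideal $\mathfrak p$ of $T$, and is Cohen–Macaulay if $\operatorname{depth}(T_{\mathfrak p})=\dim T_{\mathfrak p}$ for every prime ideal $\mathfrak p$ of $T$. If $R/\mathcal{J}_G$ satisfies Serre's condition $S_2$, then $G$ is the complete graph or $\tau(G)=\frac12$. In particular, if $R/\mathcal{J}_G$ is Cohen–Macaulay, then $G$ is the complete graph or $\tau(G)=\frac12$.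 -/

import Mathlib

open scoped NNReal ENNReal

namespace SimpleGraph

/-- `c(S)`: the number of connected components of the graph `G \ S` induced on the complement
of `S`. -/
noncomputable def componentsAfterDeletion {V : Type*} (G : SimpleGraph V) (S : Finset V) : ℕ :=
  Nat.card (G.induce (S : Set V)ᶜ).ConnectedComponent

/-- A connected graph is `t`-tough if `t * c(S) ≤ |S|` for every nonempty vertex set `S`
with `c(S) ≥ 2`. -/
def IsTough {V : Type*} (G : SimpleGraph V) (t : ℝ≥0) : Prop :=
  G.Connected ∧ ∀ S : Finset V, S.Nonempty → 2 ≤ G.componentsAfterDeletion S →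
    t * (G.componentsAfterDeletion S : ℝ≥0) ≤ (S.card : ℝ≥0)

/-- The toughness `τ(G)`: the largest `t` for which `G` is `t`-tough, and `∞` if `G` is `t`-tough
for all `t`. (The condition on `t` is closed, so a finite supremum over a nonempty set is
a maximum.) -/
noncomputable def toughness {V : Type*} (G : SimpleGraph V) : ℝ≥0∞ :=
  ⨆ t : {t : ℝ≥0 // G.IsTough t}, (t.1 : ℝ≥0∞)

/-- The binomial edge ideal `J_G = (x_i y_j - x_j y_i : {i, j} an edge of G)` in the polynomial
ring `K[x_v, y_v : v ∈ V]`, where `x_v = X (Sum.inl v)` and `y_v = X (Sum.inr v)`. -/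
noncomputable def binomialEdgeIdeal {V : Type*} (K : Type*) [Field K] (G : SimpleGraph V) :
    Ideal (MvPolynomial (V ⊕ V) K) :=
  Ideal.span {f | ∃ i j : V, G.Adj i j ∧
    f = MvPolynomial.X (Sum.inl i) * MvPolynomial.X (Sum.inr j)
      - MvPolynomial.X (Sum.inl j) * MvPolynomial.X (Sum.inr i)}

end SimpleGraph

/-- The depth of a local ring `A`: the supremum of the lengths of the `A`-regular sequences
contained in the maximal ideal. -/
noncomputable def localDepth (A : Type*) [CommRing A] [IsLocalRing A] : ℕ∞ :=
  ⨆ rs : {rs : List A // RingTheory.Sequence.IsRegular A rs ∧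
    ∀ r ∈ rs, r ∈ IsLocalRing.maximalIdeal A}, (rs.1.length : ℕ∞)

/-- Serre's condition `S_ℓ` for a Noetherian ring `T`: `depth T_p ≥ min (ℓ, dim T_p)` for every
prime ideal `p`. -/
def IsSerreS (l : ℕ) (T : Type*) [CommRing T] [IsNoetherianRing T] : Prop :=
  ∀ (p : Ideal T) [p.IsPrime],
    min (l : WithBot ℕ∞) (ringKrullDim (Localization.AtPrime p)) ≤
      (localDepth (Localization.AtPrime p) : WithBot ℕ∞)

/-- A Noetherian ring `T` is Cohen–Macaulay if `depth T_p = dim T_p` for every prime ideal `p`. -/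
def IsCohenMacaulay (T : Type*) [CommRing T] [IsNoetherianRing T] : Prop :=
  ∀ (p : Ideal T) [p.IsPrime],
    (localDepth (Localization.AtPrime p) : WithBot ℕ∞) =
      ringKrullDim (Localization.AtPrime p)

/-! Let P_S (`cutIdeal`) be the prime of the 2 × V matrices that vanish on S and have parallel
columns on each component of G \ S. Every prime over the binomial edge ideal contains some P_S, and
inclusions between such primes are purely combinatorial (`parallelIdeal_le_parallelIdeal_iff`).

By Hartshorne's connectedness lemma, under S_2 a local ring of R/J_G of dimension at least two has
connected punctured spectrum. Suppose each s in S joins several components of G \ S, and let q_s be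
the prime of matrices that vanish on S and are parallel on the components of G \ (S \ {s}). For an s
that joins as few pairs as possible, the spectrum at q_s splits into V(P_S) and the union of the
other V(P_U), which meet only in q_s; so q_s has height at most one modulo J_G
(`exists_mem_not_chain`).

This has two consequences. Merging the components of G \ S one pair at a time gives a chain from P_S
to q_s, so restoring s merges only two of them; by induction c(S) ≤ |S| + 1 ≤ 2|S|, and τ(G) ≥ 1/2.
If G is not complete and S is a smallest separating set, then killing the columns of S one at a time
gives a chain below q_s, so |S| = 1: a cut vertex exists, and τ(G) ≤ 1/2. -/

/-! ### Hartshorne's connectedness lemma -/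

theorem dvd_of_pow_mul_eq_pow_mul {B : Type*} [CommRing B] {a b : B}
    (ha : ∀ x : B, a * x = 0 → x = 0) (hab : ∀ x y : B, b * x = a * y → a ∣ x) (N M : ℕ) :
    ∀ x y : B, b ^ M * x = a ^ N * y → a ^ N ∣ x := by
  have hN : ∀ N : ℕ, ∀ x y : B, b * x = a ^ N * y → a ^ N ∣ x := by
    intro N
    induction N with
    | zero => simp
    | succ N ih =>
      intro x y h
      obtain ⟨z, rfl⟩ := hab x (a ^ N * y) (by rw [h]; ring)
      have : b * z = a ^ N * y := by
        rw [← sub_eq_zero]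
        apply ha
        linear_combination h
      rw [pow_succ']
      exact mul_dvd_mul_left a (ih z y this)
  induction M with
  | zero => intro x y h; exact ⟨y, by simpa using h⟩
  | succ M ih =>
    intro x y h
    obtain ⟨z, hz⟩ := ih (b * x) y (by rw [← h]; ring)
    exact hN N x z hz

/-- Hartshorne's connectedness lemma for two ideals with zero product. -/
theorem eq_bot_or_eq_bot_of_mul_eq_bot {B : Type*} [CommRing B] [IsLocalRing B] {a b : B}
    (ha : ∀ x : B, a * x = 0 → x = 0) (hab : ∀ x y : B, b * x = a * y → a ∣ x)
    {I J : Ideal B} (hIJ : I * J = ⊥) (haI : a ∈ I ⊔ J) (hbI : b ∈ I ⊔ J) :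
    I = ⊥ ∨ J = ⊥ := by
  have hz : ∀ x ∈ I, ∀ y ∈ J, x * y = 0 := fun x hx y hy => by
    have := Ideal.mul_mem_mul hx hy
    rwa [hIJ, Ideal.mem_bot] at this
  obtain ⟨i, hi, j, hj, rfl⟩ := Submodule.mem_sup.1 haI
  obtain ⟨i', hi', j', hj', rfl⟩ := Submodule.mem_sup.1 hbI
  -- Since IJ = 0, both b * i and a * i' equal i * i', so regularity of the pair gives i = a * c.
  -- Then j = a * (1 - c), and i * j = 0 makes c idempotent, hence 0 or 1 in a local ring.
  obtain ⟨c, hc⟩ := hab i i' (by linear_combination hz i hi j' hj' - hz i' hi' j hj)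
  have hcc : c * (1 - c) = 0 := by
    apply ha; apply ha
    have hij := hz i hi j hj
    have hj2 : j = (i + j) * (1 - c) := by linear_combination -hc
    linear_combination hij - j * hc - (i + j) * c * hj2
  rcases IsLocalRing.isUnit_or_isUnit_one_sub_self c with hu | hu
  · right
    have h1 : 1 - c = 0 := by simpa using (hu.mul_right_eq_zero).1 hcc
    have hj0 : j = 0 := by linear_combination -hc + (i + j) * h1
    rw [eq_bot_iff]
    intro y hy
    rw [Ideal.mem_bot]
    apply ha
    rw [hj0, add_zero]
    exact hz i hi y hy
  · left
    have h1 : c = 0 := by simpa using (hu.mul_left_eq_zero).1 hcc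
    have hi0 : i = 0 := by rw [hc, h1, mul_zero]
    rw [eq_bot_iff]
    intro y hy
    rw [Ideal.mem_bot]
    apply ha
    rw [hi0, zero_add, mul_comm]
    exact hz y hy j hj

/-- Hartshorne's connectedness lemma: the punctured spectrum of a Noetherian local ring with
a regular sequence of length two is not the disjoint union of two nonempty closed subsets. -/
theorem le_nilradical_or_le_nilradical {B : Type*} [CommRing B] [IsLocalRing B]
    [IsNoetherianRing B] {a b : B}
    (ha : ∀ x : B, a * x = 0 → x = 0) (hab : ∀ x y : B, b * x = a * y → a ∣ x)
    (ham : a ∈ IsLocalRing.maximalIdeal B) (hbm : b ∈ IsLocalRing.maximalIdeal B)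
    {I J : Ideal B} (hIJ : I * J ≤ nilradical B)
    (hm : IsLocalRing.maximalIdeal B ≤ (I ⊔ J).radical) :
    I ≤ nilradical B ∨ J ≤ nilradical B := by
  obtain ⟨k, hk⟩ := Ideal.exists_pow_le_of_le_radical_of_fg hIJ (IsNoetherian.noetherian _)
  have hm' : IsLocalRing.maximalIdeal B ≤ (I ^ k ⊔ J ^ k).radical := by
    refine hm.trans ?_
    rw [Ideal.radical_le_radical_iff]
    refine sup_le (fun x hx => ⟨k, ?_⟩) (fun x hx => ⟨k, ?_⟩)
    · exact Ideal.mem_sup_left (Ideal.pow_mem_pow hx k)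
    · exact Ideal.mem_sup_right (Ideal.pow_mem_pow hx k)
  obtain ⟨N, hN⟩ := hm' ham
  obtain ⟨M, hM⟩ := hm' hbm
  have haN : ∀ N : ℕ, ∀ x : B, a ^ N * x = 0 → x = 0 := by
    intro N
    induction N with
    | zero => simp
    | succ N ih =>
      intro x h
      exact ih x (ha _ (by rw [← h]; ring))
  have nil : ∀ L : Ideal B, L ^ k = ⊥ → L ≤ nilradical B := fun L hL x hx =>
    ⟨k, by simpa [hL] using Ideal.pow_mem_pow hx k⟩
  -- Powers of a regular pair again form a regular pair, and `a ^ N`, `b ^ M` lie in `I ^ k ⊔ J ^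
  -- k`, where the product is zero and not merely nilpotent.
  refine (eq_bot_or_eq_bot_of_mul_eq_bot (haN N) (dvd_of_pow_mul_eq_pow_mul ha hab N M)
    (I := I ^ k) (J := J ^ k) ?_ hN hM).imp (nil I) (nil J)
  rw [← mul_pow, eq_bot_iff]
  exact hk

theorem exists_regular_pair_of_two_le_localDepth {B : Type*} [CommRing B] [IsLocalRing B]
    (h : 2 ≤ localDepth B) :
    ∃ a ∈ IsLocalRing.maximalIdeal B, ∃ b ∈ IsLocalRing.maximalIdeal B,
      (∀ x : B, a * x = 0 → x = 0) ∧ ∀ x y : B, b * x = a * y → a ∣ x := by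
  have h1 : (1 : ℕ∞) < localDepth B := lt_of_lt_of_le (by norm_num) h
  obtain ⟨⟨rs, hreg, hmem⟩, hlen⟩ := lt_iSup_iff.1 h1
  have hlen : 1 < rs.length := by exact_mod_cast hlen
  match rs, hlen with
  | a :: b :: l, _ =>
    refine ⟨a, hmem a (by simp), b, hmem b (by simp), ?_, ?_⟩
    · intro x hx
      have := ((RingTheory.Sequence.isWeaklyRegular_cons_iff _ _ _).1 hreg.toIsWeaklyRegular).1
      exact this (by simpa using hx)
    · intro x y hxy
      have h2 := ((RingTheory.Sequence.isWeaklyRegular_cons_iff _ _ _).1 hreg.toIsWeaklyRegular).2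
      have h3 := ((RingTheory.Sequence.isWeaklyRegular_cons_iff _ _ _).1 h2).1
      have key : ∀ z : B, (Submodule.Quotient.mk z : QuotSMulTop a B) = 0 ↔ a ∣ z := by
        intro z
        rw [Submodule.Quotient.mk_eq_zero, Submodule.mem_smul_pointwise_iff_exists]
        simp [Dvd.dvd, eq_comm]
      rw [← key]
      apply h3
      simp only [smul_zero]
      rw [← Submodule.Quotient.mk_smul, key, smul_eq_mul, hxy]
      exact dvd_mul_right a y

/-! ### Serre's condition and heights of primes -/

theorem IsCohenMacaulay.isSerreS {T : Type*} [CommRing T] [IsNoetherianRing T]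
    (h : IsCohenMacaulay T) (l : ℕ) : IsSerreS l T := fun p _ => by
  rw [h p]; exact min_le_right _ _

/-- Under `S_2`, if the spectrum of the local ring at `q` is the union of two proper closed
subsets meeting only in `q`, then `q` has height at most one. -/
theorem IsSerreS.height_le_one {T : Type*} [CommRing T] [IsNoetherianRing T]
    (hT : IsSerreS 2 T) (q : Ideal T) [q.IsPrime] (I J : Ideal T)
    (hcover : ∀ p : Ideal T, p.IsPrime → p ≤ q → I ≤ p ∨ J ≤ p)
    (hmeet : ∀ p : Ideal T, p.IsPrime → p ≤ q → I ≤ p → J ≤ p → p = q)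
    (hI : ∃ p : Ideal T, p.IsPrime ∧ p ≤ q ∧ ¬ I ≤ p)
    (hJ : ∃ p : Ideal T, p.IsPrime ∧ p ≤ q ∧ ¬ J ≤ p) : q.height ≤ 1 := by
  by_contra! hht
  have h2 : (2 : ℕ∞) ≤ q.height := by
    have := Order.add_one_le_of_lt hht
    rwa [one_add_one_eq_two] at this
  let B := Localization.AtPrime q
  have hdepth : 2 ≤ localDepth B := by
    have := hT q
    rw [IsLocalization.AtPrime.ringKrullDim_eq_height q] at this
    have h2' : ((2 : ℕ) : WithBot ℕ∞) ≤ (q.height : WithBot ℕ∞) := WithBot.coe_le_coe.2 h2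
    rw [min_eq_left h2'] at this
    exact WithBot.coe_le_coe.1 this
  obtain ⟨a, ham, b, hbm, ha, hab⟩ := exists_regular_pair_of_two_le_localDepth hdepth
  have hcomap : ∀ P : Ideal B, P.IsPrime → (P.comap (algebraMap T B)) ≤ q := by
    intro P hP
    exact (Ideal.comap_mono (IsLocalRing.le_maximalIdeal hP.ne_top)).trans
      (IsLocalization.AtPrime.under_maximalIdeal B q).le
  -- An ideal that becomes nil at q lies in every prime below q; this turns the conclusion of the
  -- connectedness lemma against `hI` or `hJ`.
  have hnil : ∀ L : Ideal T, L.map (algebraMap T B) ≤ nilradical B →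
      ∀ p : Ideal T, p.IsPrime → p ≤ q → L ≤ p := by
    intro L hL p hp hpq
    have hdisj : Disjoint (q.primeCompl : Set T) (p : Set T) :=
      Set.disjoint_left.2 fun x hx hx' => hx (hpq hx')
    have hP := IsLocalization.isPrime_of_isPrime_disjoint q.primeCompl B p hp hdisj
    have hc := IsLocalization.under_map_of_isPrime_disjoint q.primeCompl B hp hdisj
    rw [← hc]
    exact Ideal.map_le_iff_le_comap.1 (hL.trans (nilradical_le_prime _))
  have hprod : I.map (algebraMap T B) * J.map (algebraMap T B) ≤ nilradical B := by
    rw [nilradical_eq_sInf]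
    refine le_sInf fun P (hP : P.IsPrime) => ?_
    rcases hcover _ (hP.comap _) (hcomap P hP) with h | h
    · exact Ideal.mul_le_left.trans (Ideal.map_le_iff_le_comap.2 h)
    · exact Ideal.mul_le_right.trans (Ideal.map_le_iff_le_comap.2 h)
  have hsum : IsLocalRing.maximalIdeal B ≤
      (I.map (algebraMap T B) ⊔ J.map (algebraMap T B)).radical := by
    rw [Ideal.radical_eq_sInf]
    refine le_sInf fun P ⟨hP1, hP⟩ => ?_
    have := hmeet _ (hP.comap (algebraMap T B)) (hcomap P hP)
      (Ideal.map_le_iff_le_comap.1 (le_sup_left.trans hP1))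
      (Ideal.map_le_iff_le_comap.1 (le_sup_right.trans hP1))
    rw [← Localization.AtPrime.map_eq_maximalIdeal]
    exact (Ideal.map_mono this.ge).trans Ideal.map_comap_le
  rcases le_nilradical_or_le_nilradical ha hab ham hbm hprod hsum with h | h
  · obtain ⟨p, hp, hpq, hn⟩ := hI
    exact hn (hnil I h p hp hpq)
  · obtain ⟨p, hp, hpq, hn⟩ := hJ
    exact hn (hnil J h p hp hpq)

/-- The version of `IsSerreS.height_le_one` for the quotient of a ring by an ideal, in terms of
the primes that contain that ideal. -/
theorem IsSerreS.not_chain_of_quotient {R : Type*} [CommRing R] {𝔞 : Ideal R}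
    [IsNoetherianRing (R ⧸ 𝔞)] (hT : IsSerreS 2 (R ⧸ 𝔞)) (q : Ideal R) [q.IsPrime] (hq : 𝔞 ≤ q)
    (I J : Ideal R)
    (hcover : ∀ p : Ideal R, p.IsPrime → 𝔞 ≤ p → p ≤ q → I ≤ p ∨ J ≤ p)
    (hmeet : ∀ p : Ideal R, p.IsPrime → 𝔞 ≤ p → p ≤ q → I ≤ p → J ≤ p → q ≤ p)
    (hI : ∃ p : Ideal R, p.IsPrime ∧ 𝔞 ≤ p ∧ p ≤ q ∧ ¬ I ≤ p)
    (hJ : ∃ p : Ideal R, p.IsPrime ∧ 𝔞 ≤ p ∧ p ≤ q ∧ ¬ J ≤ p)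
    (p₀ p₁ : Ideal R) (hp₀ : p₀.IsPrime) (hp₁ : p₁.IsPrime) (h𝔞 : 𝔞 ≤ p₀)
    (h01 : p₀ < p₁) (h1q : p₁ < q) : False := by
  let π := Ideal.Quotient.mk 𝔞
  have hπ : Function.Surjective π := Ideal.Quotient.mk_surjective
  have hker : RingHom.ker π = 𝔞 := Ideal.mk_ker
  have hprime : ∀ p : Ideal R, p.IsPrime → 𝔞 ≤ p → (p.map π).IsPrime := fun p hp h =>
    Ideal.map_isPrime_of_surjective hπ (hker.trans_le h)
  have hcm : ∀ p : Ideal R, 𝔞 ≤ p → (p.map π).comap π = p := fun p h => by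
    rw [Ideal.comap_map_of_surjective π hπ, ← RingHom.ker_eq_comap_bot, hker, sup_eq_left.2 h]
  have hle : ∀ P : Ideal (R ⧸ 𝔞), 𝔞 ≤ P.comap π := fun P => by
    exact hker.symm.trans_le (Ideal.ker_le_comap π)
  have hcq : ∀ P : Ideal (R ⧸ 𝔞), P ≤ q.map π → P.comap π ≤ q := fun P h => by
    rw [← hcm q hq]; exact Ideal.comap_mono h
  have := hprime q inferInstance hq
  have hlt : ∀ p p' : Ideal R, 𝔞 ≤ p → 𝔞 ≤ p' → p < p' → p.map π < p'.map π := by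
    intro p p' h h' hpp
    refine lt_of_le_of_ne (Ideal.map_mono hpp.le) fun he => hpp.ne ?_
    rw [← hcm p h, he, hcm p' h']
  have key := hT.height_le_one (q.map π) (I.map π) (J.map π) ?_ ?_ ?_ ?_
  · have := hprime p₀ hp₀ h𝔞
    have := hprime p₁ hp₁ (h𝔞.trans h01.le)
    have h1 := Ideal.height_add_one_le_of_lt_of_isPrime
      (hlt p₀ p₁ h𝔞 (h𝔞.trans h01.le) h01)
    have h2 := Ideal.height_add_one_le_of_lt_of_isPrime
      (hlt p₁ q (h𝔞.trans h01.le) hq h1q)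
    have h3 : (p₀.map π).height + 1 + 1 ≤ 1 := (add_le_add_left h1 1).trans (h2.trans key)
    have h4 : (1 + 1 : ℕ∞) ≤ 1 := le_trans (add_le_add_left le_add_self 1) h3
    norm_num at h4
  · intro P hP hPq
    exact (hcover _ (hP.comap π) (hle P) (hcq P hPq)).imp
      Ideal.map_le_iff_le_comap.2 Ideal.map_le_iff_le_comap.2
  · intro P hP hPq h1 h2
    refine le_antisymm hPq (Ideal.map_le_iff_le_comap.2 ?_)
    exact hmeet _ (hP.comap π) (hle P) (hcq P hPq)
      (Ideal.map_le_iff_le_comap.1 h1) (Ideal.map_le_iff_le_comap.1 h2)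
  · obtain ⟨p, hp, h𝔞p, hpq, hn⟩ := hI
    refine ⟨p.map π, hprime p hp h𝔞p, Ideal.map_mono hpq, fun h => hn ?_⟩
    rw [← hcm p h𝔞p]; exact Ideal.map_le_iff_le_comap.1 h
  · obtain ⟨p, hp, h𝔞p, hpq, hn⟩ := hJ
    refine ⟨p.map π, hprime p hp h𝔞p, Ideal.map_mono hpq, fun h => hn ?_⟩
    rw [← hcm p h𝔞p]; exact Ideal.map_le_iff_le_comap.1 h

/-! ### Primes of matrices with parallel columns -/

open MvPolynomial

/-- The `2 × 2` minor `x_i y_j - x_j y_i` of the generic `2 × V` matrix. -/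
noncomputable def genericMinor (K : Type*) [Field K] {V : Type*} (i j : V) :
    MvPolynomial (V ⊕ V) K :=
  X (Sum.inl i) * X (Sum.inr j) - X (Sum.inl j) * X (Sum.inr i)

open Classical in
/-- The parametrization of the `2 × V` matrices whose columns in `S` vanish and whose columns
outside `S` with the same label are parallel: the column of `v ∉ S` is `t_v • (a_{f v}, b_{f v})`. -/
noncomputable def parallelParam (K : Type*) [Field K] {V ι : Type*} (S : Finset V) (f : V → ι) :
    MvPolynomial (V ⊕ V) K →ₐ[K] MvPolynomial (V ⊕ (ι ⊕ ι)) K :=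
  aeval (Sum.elim
    (fun v => if v ∈ S then 0 else X (Sum.inl v) * X (Sum.inr (Sum.inl (f v))))
    (fun v => if v ∈ S then 0 else X (Sum.inl v) * X (Sum.inr (Sum.inr (f v)))))

/-- The prime ideal of the closure of the set of `2 × V` matrices whose columns in `S` vanish and
whose columns outside `S` with the same label are parallel. -/
noncomputable def parallelIdeal (K : Type*) [Field K] {V ι : Type*} (S : Finset V) (f : V → ι) :
    Ideal (MvPolynomial (V ⊕ V) K) :=
  RingHom.ker (parallelParam K S f)

section

variable {K : Type*} [Field K] {V ι κ : Type*} {S T : Finset V} {f : V → ι} {g : V → κ}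

instance parallelIdeal_isPrime : (parallelIdeal K S f).IsPrime := RingHom.ker_isPrime _

theorem X_inl_mem_parallelIdeal_iff {i : V} : X (Sum.inl i) ∈ parallelIdeal K S f ↔ i ∈ S := by
  by_cases h : i ∈ S <;> simp [parallelIdeal, parallelParam, RingHom.mem_ker, h, X_ne_zero]

theorem X_inr_mem_parallelIdeal_iff {i : V} : X (Sum.inr i) ∈ parallelIdeal K S f ↔ i ∈ S := by
  by_cases h : i ∈ S <;> simp [parallelIdeal, parallelParam, RingHom.mem_ker, h, X_ne_zero]

theorem genericMinor_mem_parallelIdeal_iff {i j : V} (hi : i ∉ S) (hj : j ∉ S) :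
    genericMinor K i j ∈ parallelIdeal K S f ↔ f i = f j := by
  classical
  simp only [parallelIdeal, parallelParam, RingHom.mem_ker, genericMinor, map_sub, map_mul,
    aeval_X, Sum.elim_inl, Sum.elim_inr, hi, hj, if_false]
  constructor
  · intro h
    by_contra hne
    -- At this point the columns of i and j are the two unit vectors, so the minor takes the value
    -- 1.
    have := congrArg (eval (Sum.elim (fun _ => (1 : K))
      (Sum.elim (fun c => if c = f i then 1 else 0) fun c => if c = f j then 1 else 0))) h
    simp [hne] at this
  · intro h
    rw [h]; ring

theorem genericMinor_mem_parallelIdeal {i j : V} (h : i ∉ S → j ∉ S → f i = f j) :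
    genericMinor K i j ∈ parallelIdeal K S f := by
  by_cases hi : i ∈ S
  · exact sub_mem (Ideal.mul_mem_right _ _ (X_inl_mem_parallelIdeal_iff.2 hi))
      (Ideal.mul_mem_left _ _ (X_inr_mem_parallelIdeal_iff.2 hi))
  by_cases hj : j ∈ S
  · exact sub_mem (Ideal.mul_mem_left _ _ (X_inr_mem_parallelIdeal_iff.2 hj))
      (Ideal.mul_mem_right _ _ (X_inl_mem_parallelIdeal_iff.2 hj))
  exact (genericMinor_mem_parallelIdeal_iff hi hj).2 (h hi hj)

theorem exists_eq_mul_of_mul_eq_mul {F : Type*} [Field F] {x y x' y' : F}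
    (hne : x' ≠ 0 ∨ y' ≠ 0) (h : x * y' = x' * y) : ∃ t : F, x = t * x' ∧ y = t * y' := by
  rcases hne with hne | hne
  · exact ⟨x / x', by field_simp, by field_simp; linear_combination -h⟩
  · exact ⟨y / y', by field_simp; linear_combination h, by field_simp⟩

/-- Parallelism is transitive through a column that is nonzero at Q: a nonzero entry of column v
times the (u, w) minor is a combination of the other two minors. -/
theorem genericMinor_mem_trans (Q : Ideal (MvPolynomial (V ⊕ V) K)) [hQ : Q.IsPrime] {u v w : V}
    (hv : X (Sum.inl v) ∉ Q ∨ X (Sum.inr v) ∉ Q) (huv : genericMinor K u v ∈ Q)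
    (hvw : genericMinor K v w ∈ Q) : genericMinor K u w ∈ Q := by
  rcases hv with hv | hv
  · refine (hQ.mem_or_mem (x := X (Sum.inl v)) ?_).resolve_left hv
    have : X (Sum.inl v) * genericMinor K u w =
        X (Sum.inl u) * genericMinor K v w + X (Sum.inl w) * genericMinor K u v := by
      simp only [genericMinor]; ring
    rw [this]
    exact add_mem (Ideal.mul_mem_left _ _ hvw) (Ideal.mul_mem_left _ _ huv)
  · refine (hQ.mem_or_mem (x := X (Sum.inr v)) ?_).resolve_left hv
    have : X (Sum.inr v) * genericMinor K u w =
        X (Sum.inr u) * genericMinor K v w + X (Sum.inr w) * genericMinor K u v := by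
      simp only [genericMinor]; ring
    rw [this]
    exact add_mem (Ideal.mul_mem_left _ _ hvw) (Ideal.mul_mem_left _ _ huv)

/-- The matrix at the generic point of V(Q), with entries in the fraction field of the quotient by
Q, has the prescribed zero and parallel columns. Hence it is a value of the parametrization, whose
kernel therefore vanishes there. -/
theorem parallelIdeal_le_of_isPrime (Q : Ideal (MvPolynomial (V ⊕ V) K)) [Q.IsPrime]
    (hx : ∀ i ∈ S, X (Sum.inl i) ∈ Q) (hy : ∀ i ∈ S, X (Sum.inr i) ∈ Q)
    (hminor : ∀ i ∉ S, ∀ j ∉ S, f i = f j → genericMinor K i j ∈ Q) :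
    parallelIdeal K S f ≤ Q := by
  classical
  let D := MvPolynomial (V ⊕ V) K ⧸ Q
  let F := FractionRing D
  let θ : MvPolynomial (V ⊕ V) K →ₐ[K] F :=
    (IsScalarTower.toAlgHom K D F).comp (Ideal.Quotient.mkₐ K Q)
  have hθ : ∀ r, θ r = 0 ↔ r ∈ Q := by
    intro r
    have : θ r = algebraMap D F (Ideal.Quotient.mk Q r) := rfl
    rw [this, FaithfulSMul.algebraMap_eq_zero_iff, Ideal.Quotient.eq_zero_iff_mem]
  let x : V → F := fun v => θ (X (Sum.inl v))
  let y : V → F := fun v => θ (X (Sum.inr v))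
  have hxy : ∀ i ∉ S, ∀ j ∉ S, f i = f j → x i * y j = x j * y i := by
    intro i hi j hj h
    have := (hθ _).2 (hminor i hi j hj h)
    simpa [genericMinor, sub_eq_zero] using this
  -- The direction of a class is any nonzero column in it; it is 0 when all of them vanish.
  let d : ι → F × F := fun c =>
    if h : ∃ i, i ∉ S ∧ f i = c ∧ (x i ≠ 0 ∨ y i ≠ 0) then (x h.choose, y h.choose) else 0
  have ht : ∀ v, ∃ t : F, v ∉ S → x v = t * (d (f v)).1 ∧ y v = t * (d (f v)).2 := by
    intro v
    by_cases h0 : x v = 0 ∧ y v = 0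
    · exact ⟨0, fun _ => by simp [h0]⟩
    by_cases hv : v ∈ S
    · exact ⟨0, fun h => absurd hv h⟩
    have h : ∃ i, i ∉ S ∧ f i = f v ∧ (x i ≠ 0 ∨ y i ≠ 0) := ⟨v, hv, rfl, by tauto⟩
    have hd : d (f v) = (x h.choose, y h.choose) := dif_pos h
    obtain ⟨hi, hfi, hne⟩ := h.choose_spec
    rw [hd]
    have hm := hxy v hv _ hi hfi.symm
    generalize h.choose = i at *
    obtain ⟨t, h1, h2⟩ := exists_eq_mul_of_mul_eq_mul hne hm
    exact ⟨t, fun _ => ⟨h1, h2⟩⟩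
  choose t ht using ht
  let ψ : MvPolynomial (V ⊕ (ι ⊕ ι)) K →ₐ[K] F :=
    aeval (Sum.elim t (Sum.elim (fun c => (d c).1) fun c => (d c).2))
  have hψ : ψ.comp (parallelParam K S f) = θ := by
    ext v
    rcases v with v | v
    · by_cases hv : v ∈ S
      · simpa [parallelParam, hv] using ((hθ _).2 (hx v hv)).symm
      · simpa [parallelParam, hv, ψ] using (ht v hv).1.symm
    · by_cases hv : v ∈ S
      · simpa [parallelParam, hv] using ((hθ _).2 (hy v hv)).symm
      · simpa [parallelParam, hv, ψ] using (ht v hv).2.symm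
  intro r hr
  rw [← hθ, ← hψ, AlgHom.comp_apply, (RingHom.mem_ker).1 hr, map_zero]

/-- The variables in such a prime recover the zero columns, and its minors recover the labels off
them. -/
theorem parallelIdeal_le_parallelIdeal_iff :
    parallelIdeal K S f ≤ parallelIdeal K T g ↔
      S ⊆ T ∧ ∀ i ∉ T, ∀ j ∉ T, f i = f j → g i = g j := by
  constructor
  · intro h
    have hST : S ⊆ T := fun i hi =>
      X_inl_mem_parallelIdeal_iff.1 (h (X_inl_mem_parallelIdeal_iff.2 hi))
    exact ⟨hST, fun i hi j hj hf => (genericMinor_mem_parallelIdeal_iff hi hj).1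
      (h (genericMinor_mem_parallelIdeal fun _ _ => hf))⟩
  · rintro ⟨hST, h⟩
    exact parallelIdeal_le_of_isPrime _ (fun i hi => X_inl_mem_parallelIdeal_iff.2 (hST hi))
      (fun i hi => X_inr_mem_parallelIdeal_iff.2 (hST hi))
      fun i _ j _ hf => genericMinor_mem_parallelIdeal fun hi hj => h i hi j hj hf

end

/-! ### Cut ideals and the primes over the binomial edge ideal -/

namespace SimpleGraph

variable {K : Type*} [Field K] {V : Type*} {G : SimpleGraph V}

theorem binomialEdgeIdeal_le_parallelIdeal {ι : Type*} {S : Finset V} {f : V → ι}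
    (h : ∀ i ∉ S, ∀ j ∉ S, G.Adj i j → f i = f j) :
    G.binomialEdgeIdeal K ≤ parallelIdeal K S f := by
  refine Ideal.span_le.2 ?_
  rintro _ ⟨i, j, hij, rfl⟩
  exact genericMinor_mem_parallelIdeal fun hi hj => h i hi j hj hij

open Classical in
/-- The component of `G \ S` that contains a vertex, with a default value on `S`. -/
noncomputable def deletionLabel (G : SimpleGraph V) (S : Finset V) (v : V) :
    Option (G.induce (S : Set V)ᶜ).ConnectedComponent :=
  if h : v ∈ S then none else some (connectedComponentMk _ ⟨v, h⟩)

theorem deletionLabel_of_notMem {S : Finset V} {v : V} (h : v ∉ S) :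
    G.deletionLabel S v = some (connectedComponentMk _ ⟨v, h⟩) := dif_neg h

theorem deletionLabel_eq_iff {S : Finset V} {i j : V} (hi : i ∉ S) (hj : j ∉ S) :
    G.deletionLabel S i = G.deletionLabel S j ↔
      (G.induce (S : Set V)ᶜ).Reachable ⟨i, hi⟩ ⟨j, hj⟩ := by
  rw [deletionLabel_of_notMem hi, deletionLabel_of_notMem hj, Option.some_inj,
    ConnectedComponent.eq]

theorem deletionLabel_eq_of_adj {S : Finset V} {i j : V} (hi : i ∉ S) (hj : j ∉ S)
    (h : G.Adj i j) : G.deletionLabel S i = G.deletionLabel S j :=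
  (deletionLabel_eq_iff hi hj).2 (Adj.reachable (by simpa using h))

theorem deletionLabel_eq_of_subset {S T : Finset V} (hST : S ⊆ T) {i j : V} (hi : i ∉ T)
    (hj : j ∉ T) (h : G.deletionLabel T i = G.deletionLabel T j) :
    G.deletionLabel S i = G.deletionLabel S j := by
  rw [deletionLabel_eq_iff (fun h => hi (hST h)) (fun h => hj (hST h))]
  have hle : (T : Set V)ᶜ ≤ (S : Set V)ᶜ := Set.compl_subset_compl.2 (by exact_mod_cast hST)
  exact ((deletionLabel_eq_iff hi hj).1 h).map (G.induceHomOfLE hle).toHom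

/-- The prime ideal of the matrices whose columns in `S` vanish and whose columns in each
component of `G \ S` are parallel. -/
noncomputable abbrev cutIdeal (K : Type*) [Field K] (G : SimpleGraph V) (S : Finset V) :
    Ideal (MvPolynomial (V ⊕ V) K) :=
  parallelIdeal K S (G.deletionLabel S)

theorem binomialEdgeIdeal_le_cutIdeal (S : Finset V) :
    G.binomialEdgeIdeal K ≤ G.cutIdeal K S :=
  binomialEdgeIdeal_le_parallelIdeal fun _ hi _ hj h => deletionLabel_eq_of_adj hi hj h

theorem genericMinor_mem_of_walk (Q : Ideal (MvPolynomial (V ⊕ V) K)) [Q.IsPrime]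
    (hQ : G.binomialEdgeIdeal K ≤ Q) {s : Set V}
    (hs : ∀ v ∈ s, (X (Sum.inl v) : MvPolynomial (V ⊕ V) K) ∉ Q ∨
      (X (Sum.inr v) : MvPolynomial (V ⊕ V) K) ∉ Q) {u v : s} (w : (G.induce s).Walk u v) :
    genericMinor K (u : V) (v : V) ∈ Q := by
  induction w with
  | nil => simp [genericMinor]
  | @cons u v w h _ ih =>
    exact genericMinor_mem_trans Q (hs v v.2) (hQ (Ideal.subset_span ⟨u, v, h, rfl⟩)) ih

theorem genericMinor_mem_of_reachable (Q : Ideal (MvPolynomial (V ⊕ V) K)) [Q.IsPrime]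
    (hQ : G.binomialEdgeIdeal K ≤ Q) {s : Set V}
    (hs : ∀ v ∈ s, (X (Sum.inl v) : MvPolynomial (V ⊕ V) K) ∉ Q ∨
      (X (Sum.inr v) : MvPolynomial (V ⊕ V) K) ∉ Q) {u v : s} (h : (G.induce s).Reachable u v) :
    genericMinor K (u : V) (v : V) ∈ Q :=
  h.elim (genericMinor_mem_of_walk Q hQ hs)

theorem cutIdeal_le_of_isPrime (Q : Ideal (MvPolynomial (V ⊕ V) K)) [Q.IsPrime]
    (hQ : G.binomialEdgeIdeal K ≤ Q) {S : Finset V}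
    (hS : ∀ v ∈ S, (X (Sum.inl v) : MvPolynomial (V ⊕ V) K) ∈ Q ∧
      (X (Sum.inr v) : MvPolynomial (V ⊕ V) K) ∈ Q)
    (hS' : ∀ v ∉ S, (X (Sum.inl v) : MvPolynomial (V ⊕ V) K) ∉ Q ∨
      (X (Sum.inr v) : MvPolynomial (V ⊕ V) K) ∉ Q) : G.cutIdeal K S ≤ Q := by
  have h : ∀ i ∉ S, ∀ j ∉ S, G.deletionLabel S i = G.deletionLabel S j →
      genericMinor K i j ∈ Q := fun i hi j hj hij =>
    genericMinor_mem_of_reachable (s := (S : Set V)ᶜ) (u := ⟨i, hi⟩) (v := ⟨j, hj⟩) Q hQ hS'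
      ((deletionLabel_eq_iff hi hj).1 hij)
  exact parallelIdeal_le_of_isPrime Q (fun i hi => (hS i hi).1) (fun i hi => (hS i hi).2) h

theorem exists_cutIdeal_le [Fintype V] (Q : Ideal (MvPolynomial (V ⊕ V) K)) [Q.IsPrime]
    (hQ : G.binomialEdgeIdeal K ≤ Q) : ∃ S : Finset V, G.cutIdeal K S ≤ Q := by
  classical
  -- S is the set of columns that vanish at Q; along walks outside S parallelism then propagates.
  refine ⟨Finset.univ.filter fun v => (X (Sum.inl v) : MvPolynomial (V ⊕ V) K) ∈ Q ∧
    (X (Sum.inr v) : MvPolynomial (V ⊕ V) K) ∈ Q, cutIdeal_le_of_isPrime Q hQ ?_ ?_⟩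
  · intro v hv
    simpa using hv
  · intro v hv
    exact not_and_or.1 (by simpa using hv)

end SimpleGraph

/-! ### Vertex deletion under S_2 -/

namespace SimpleGraph

variable {K : Type*} [Field K] {V : Type*} {G : SimpleGraph V}

/-- The map on components that forgets the deletion of one vertex. -/
noncomputable def restoreVertex [DecidableEq V] (G : SimpleGraph V) (S : Finset V) (s : V) :
    (G.induce (S : Set V)ᶜ).ConnectedComponent →
      (G.induce ((S.erase s : Finset V) : Set V)ᶜ).ConnectedComponent :=
  ConnectedComponent.map (G.induceHomOfLE
    (Set.compl_subset_compl.2 (Finset.coe_subset.2 (S.erase_subset s)))).toHom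

theorem restoreVertex_mk_eq_iff [DecidableEq V] {S : Finset V} {s i j : V} (hi : i ∉ S) (hj : j ∉ S) :
    G.restoreVertex S s (connectedComponentMk _ ⟨i, hi⟩) =
      G.restoreVertex S s (connectedComponentMk _ ⟨j, hj⟩) ↔
    G.deletionLabel (S.erase s) i = G.deletionLabel (S.erase s) j := by
  rw [deletionLabel_eq_iff (fun h => hi (Finset.mem_of_mem_erase h))
    (fun h => hj (Finset.mem_of_mem_erase h)), ← ConnectedComponent.eq]
  rfl

theorem connectedComponentMk_ne_iff {S : Finset V} {i j : V} (hi : i ∉ S) (hj : j ∉ S) :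
    (G.induce (S : Set V)ᶜ).connectedComponentMk ⟨i, hi⟩ ≠ connectedComponentMk _ ⟨j, hj⟩ ↔
      G.deletionLabel S i ≠ G.deletionLabel S j := by
  rw [Ne, ConnectedComponent.eq, Ne, deletionLabel_eq_iff hi hj]

variable [Fintype V] [DecidableEq V]

/-- If every vertex of `S` joins several components of `G \ S`, then for some `s ∈ S` the prime
of the matrices that vanish on `S` and are parallel on the components of `G \ (S \ {s})` has
height at most one modulo the binomial edge ideal. -/
theorem exists_mem_not_chain
    (hT : IsSerreS 2 (MvPolynomial (V ⊕ V) K ⧸ G.binomialEdgeIdeal K))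
    {S : Finset V} (hne : S.Nonempty)
    (hS : ∀ s ∈ S, ∃ i ∉ S, ∃ j ∉ S,
      G.deletionLabel (S.erase s) i = G.deletionLabel (S.erase s) j ∧
        G.deletionLabel S i ≠ G.deletionLabel S j) :
    ∃ s ∈ S, ∀ p₀ p₁ : Ideal (MvPolynomial (V ⊕ V) K), p₀.IsPrime → p₁.IsPrime →
      G.binomialEdgeIdeal K ≤ p₀ → p₀ < p₁ →
      p₁ < parallelIdeal K S (G.deletionLabel (S.erase s)) → False := by
  classical
  let r : Finset V → Finset (V × V) := fun U =>
    {e | e.1 ∉ S ∧ e.2 ∉ S ∧ G.deletionLabel U e.1 = G.deletionLabel U e.2}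
  have hr : ∀ U i j, (i, j) ∈ r U ↔
      i ∉ S ∧ j ∉ S ∧ G.deletionLabel U i = G.deletionLabel U j := by simp [r]
  -- Minimality of the number of identified pairs is what forces the two closed sets to meet only in
  -- q.
  obtain ⟨s, hs, hmin⟩ := S.exists_min_image (fun s => (r (S.erase s)).card) hne
  have hsub : ∀ s, S.erase s ⊆ S := fun s => S.erase_subset s
  refine ⟨s, hs, ?_⟩
  set q := parallelIdeal K S (G.deletionLabel (S.erase s)) with hq
  have hSq : G.cutIdeal K S ≤ q := parallelIdeal_le_parallelIdeal_iff.2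
    ⟨subset_rfl, fun i hi j hj h => deletionLabel_eq_of_subset (hsub s) hi hj h⟩
  -- These index the other cut ideals below q. Each such U is a proper subset of S, so it lies in
  -- some `S.erase s'`.
  let 𝒰 : Finset (Finset V) := {U | U ≠ S ∧ G.cutIdeal K U ≤ q}
  have h𝒰 : ∀ U, U ∈ 𝒰 ↔ U ≠ S ∧ G.cutIdeal K U ≤ q := by simp [𝒰]
  have hinf : ∀ p : Ideal (MvPolynomial (V ⊕ V) K), p.IsPrime →
      𝒰.inf (G.cutIdeal K) ≤ p → ∃ U ⊆ S, (∃ s' ∈ S, U ⊆ S.erase s') ∧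
        G.cutIdeal K U ≤ q ∧ G.cutIdeal K U ≤ p := by
    intro p hp h
    obtain ⟨U, hU, hUp⟩ := (Ideal.IsPrime.inf_le' hp).1 h
    obtain ⟨hUS, hUq⟩ := (h𝒰 U).1 hU
    have hUsub := (parallelIdeal_le_parallelIdeal_iff.1 hUq).1
    obtain ⟨s', hs', hs'U⟩ := Finset.exists_of_ssubset (lt_of_le_of_ne hUsub hUS)
    exact ⟨U, hUsub, ⟨s', hs', Finset.subset_erase.2 ⟨hUsub, hs'U⟩⟩, hUq, hUp⟩
  refine hT.not_chain_of_quotient q ((binomialEdgeIdeal_le_cutIdeal S).trans hSq)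
    (G.cutIdeal K S) (𝒰.inf (G.cutIdeal K)) ?_ ?_ ?_ ?_
  · intro p hp hJp hpq
    obtain ⟨U, hU⟩ := exists_cutIdeal_le p hJp
    by_cases hUS : U = S
    · exact Or.inl (hUS ▸ hU)
    · exact Or.inr ((Finset.inf_le ((h𝒰 U).2 ⟨hUS, hU.trans hpq⟩)).trans hU)
  · intro p hp hJp hpq hSp hUp
    obtain ⟨U, hUS, ⟨s', hs', hUs'⟩, hUq, hUp⟩ := hinf p hp hUp
    have h1 : r (S.erase s') ⊆ r U := by
      rintro ⟨i, j⟩ hij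
      obtain ⟨hi, hj, h⟩ := (hr _ _ _).1 hij
      exact (hr _ _ _).2 ⟨hi, hj, deletionLabel_eq_of_subset hUs'
        (fun h => hi (hsub _ h)) (fun h => hj (hsub _ h)) h⟩
    have h2 : r U ⊆ r (S.erase s) := by
      rintro ⟨i, j⟩ hij
      obtain ⟨hi, hj, h⟩ := (hr _ _ _).1 hij
      exact (hr _ _ _).2 ⟨hi, hj, (parallelIdeal_le_parallelIdeal_iff.1 hUq).2 i hi j hj h⟩
    -- The relations of `S.erase s'` lie in those of U, which lie in those of `S.erase s`;
    -- minimality collapses this chain.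
    have h3 : r (S.erase s) ⊆ r U :=
      (Finset.eq_of_subset_of_card_le (h1.trans h2) (hmin s' hs')).symm.subset.trans h1
    refine parallelIdeal_le_of_isPrime p
      (fun i hi => hSp (X_inl_mem_parallelIdeal_iff.2 hi))
      (fun i hi => hSp (X_inr_mem_parallelIdeal_iff.2 hi)) fun i hi j hj h => hUp ?_
    exact genericMinor_mem_parallelIdeal fun _ _ =>
      ((hr _ _ _).1 (h3 ((hr _ _ _).2 ⟨hi, hj, h⟩))).2.2
  · refine ⟨G.cutIdeal K (S.erase s), inferInstance, binomialEdgeIdeal_le_cutIdeal _,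
      parallelIdeal_le_parallelIdeal_iff.2 ⟨hsub s, fun i _ j _ h => h⟩, fun h => ?_⟩
    exact Finset.notMem_erase s S ((parallelIdeal_le_parallelIdeal_iff.1 h).1 hs)
  · refine ⟨G.cutIdeal K S, inferInstance, binomialEdgeIdeal_le_cutIdeal _, hSq, fun h => ?_⟩
    obtain ⟨U, hUS, ⟨s', hs', hUs'⟩, -, hUp⟩ := hinf _ inferInstance h
    obtain ⟨i, hi, j, hj, hij, hne⟩ := hS s' hs'
    exact hne ((parallelIdeal_le_parallelIdeal_iff.1 hUp).2 i hi j hj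
      (deletionLabel_eq_of_subset hUs' (fun h => hi (hsub _ h)) (fun h => hj (hsub _ h)) hij))

/-- Among the primes of `exists_mem_not_chain`, height at most one means that at most two
components of `G \ S` are joined. -/
theorem exists_mem_pairs_meet
    (hT : IsSerreS 2 (MvPolynomial (V ⊕ V) K ⧸ G.binomialEdgeIdeal K))
    {S : Finset V} (hne : S.Nonempty)
    (hS : ∀ s ∈ S, ∃ i ∉ S, ∃ j ∉ S,
      G.deletionLabel (S.erase s) i = G.deletionLabel (S.erase s) j ∧
        G.deletionLabel S i ≠ G.deletionLabel S j) :
    ∃ s ∈ S, ∀ i ∉ S, ∀ j ∉ S, ∀ k ∉ S, ∀ l ∉ S,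
      G.deletionLabel (S.erase s) i = G.deletionLabel (S.erase s) j →
      G.deletionLabel S i ≠ G.deletionLabel S j →
      G.deletionLabel (S.erase s) k = G.deletionLabel (S.erase s) l →
      G.deletionLabel S k ≠ G.deletionLabel S l →
      G.deletionLabel S k = G.deletionLabel S j ∨ G.deletionLabel S l = G.deletionLabel S j := by
  classical
  obtain ⟨s, hs, hchain⟩ := exists_mem_not_chain hT hne hS
  refine ⟨s, hs, fun i hi j hj k hk l hl hij hij' hkl hkl' => ?_⟩
  by_contra! hcon
  let f := G.deletionLabel S
  -- This merges only the components of i and j. A second merged pair avoiding the component of j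
  -- makes the resulting prime strictly intermediate.
  let f' := fun v => if f v = f j then f i else f v
  have hf : ∀ u v, f u = f v → f' u = f' v := fun u v h => by simp only [f', h]
  have hmono := fun u (hu : u ∉ S) v (hv : v ∉ S) =>
    deletionLabel_eq_of_subset (G := G) (S.erase_subset s) hu hv
  have hij'' : f' i = f' j := by simp [f']
  refine hchain (G.cutIdeal K S) (parallelIdeal K S f') inferInstance inferInstance
    (binomialEdgeIdeal_le_cutIdeal S) (lt_of_le_not_ge ?_ ?_) (lt_of_le_not_ge ?_ ?_)
  · exact parallelIdeal_le_parallelIdeal_iff.2 ⟨subset_rfl, fun u _ v _ => hf u v⟩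
  · intro h
    exact hij' ((parallelIdeal_le_parallelIdeal_iff.1 h).2 i hi j hj hij'')
  · refine parallelIdeal_le_parallelIdeal_iff.2 ⟨subset_rfl, fun u hu v hv h => ?_⟩
    by_cases hu' : f u = f j <;> by_cases hv' : f v = f j
    · exact hmono u hu v hv (hu'.trans hv'.symm)
    · have h' : f i = f v := by simpa [f', hu', hv'] using h
      exact (hmono u hu j hj hu').trans (hij.symm.trans (hmono i hi v hv h'))
    · have h' : f u = f i := by simpa [f', hu', hv'] using h
      exact (hmono u hu i hi h').trans (hij.trans (hmono v hv j hj hv').symm)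
    · exact hmono u hu v hv (by simpa [f', hu', hv'] using h)
  · intro h
    have := (parallelIdeal_le_parallelIdeal_iff.1 h).2 k hk l hl hkl
    refine hkl' ?_
    simpa [f', f, hcon.1, hcon.2] using this

theorem card_le_card_add_one_of_pairs_meet {A B : Type*} [Finite A] [Finite B] (g : A → B)
    (h : ∀ a b c d : A, g a = g b → a ≠ b → g c = g d → c ≠ d → c = b ∨ d = b) :
    Nat.card A ≤ Nat.card B + 1 := by
  classical
  by_cases hg : Function.Injective g
  · exact (Nat.card_le_card_of_injective g hg).trans (Nat.le_succ _)
  obtain ⟨a, b, hab, hne⟩ : ∃ a b, g a = g b ∧ a ≠ b := by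
    simpa [Function.Injective] using hg
  have : Function.Injective fun x : A => if x = b then none else some (g x) := by
    intro c d hcd
    by_contra hcd'
    by_cases hc : c = b <;> by_cases hd : d = b
    · exact hcd' (hc.trans hd.symm)
    · simp [hc, hd] at hcd
    · simp [hc, hd] at hcd
    · rcases h a b c d hab hne (by simpa [hc, hd] using hcd) hcd' with h | h
      exacts [hc h, hd h]
  refine (Nat.card_le_card_of_injective _ this).trans ?_
  rw [Finite.card_option]

theorem componentsAfterDeletion_le_card_add_one (hG : G.Connected)
    (hT : IsSerreS 2 (MvPolynomial (V ⊕ V) K ⧸ G.binomialEdgeIdeal K)) (S : Finset V) :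
    G.componentsAfterDeletion S ≤ S.card + 1 := by
  induction hn : S.card generalizing S with
  | zero =>
    rw [Finset.card_eq_zero] at hn
    subst hn
    have : Subsingleton (G.induce ((∅ : Finset V) : Set V)ᶜ).ConnectedComponent := by
      refine ⟨ConnectedComponent.ind₂ fun u v => ConnectedComponent.eq.2 ?_⟩
      obtain ⟨w⟩ := hG.preconnected u v
      exact ⟨w.map (⟨fun v => ⟨v, by simp⟩, fun h => by simpa using h⟩ :
        G →g G.induce ((∅ : Finset V) : Set V)ᶜ)⟩
    exact Finite.card_le_one_iff_subsingleton.2 this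
  | succ n ih =>
    have key : ∃ s ∈ S, G.componentsAfterDeletion S ≤ G.componentsAfterDeletion (S.erase s) + 1 := by
      by_cases hS : ∀ s ∈ S, ∃ i ∉ S, ∃ j ∉ S,
        G.deletionLabel (S.erase s) i = G.deletionLabel (S.erase s) j ∧
          G.deletionLabel S i ≠ G.deletionLabel S j
      · obtain ⟨s, hs, h⟩ := exists_mem_pairs_meet hT
          (Finset.card_pos.1 (by omega)) hS
        refine ⟨s, hs, card_le_card_add_one_of_pairs_meet (G.restoreVertex S s) ?_⟩
        refine ConnectedComponent.ind₂ fun ⟨i, hi⟩ ⟨j, hj⟩ =>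
          ConnectedComponent.ind₂ fun ⟨k, hk⟩ ⟨l, hl⟩ => ?_
        intro h1 h2 h3 h4
        rw [restoreVertex_mk_eq_iff] at h1 h3
        rw [connectedComponentMk_ne_iff] at h2 h4
        simpa only [ConnectedComponent.eq, deletionLabel_eq_iff hk hj, deletionLabel_eq_iff hl hj]
          using h i hi j hj k hk l hl h1 h2 h3 h4
      · push Not at hS
        obtain ⟨s, hs, h⟩ := hS
        refine ⟨s, hs, (Nat.card_le_card_of_injective (G.restoreVertex S s) ?_).trans
          (Nat.le_succ _)⟩
        refine ConnectedComponent.ind₂ fun ⟨i, hi⟩ ⟨j, hj⟩ h1 => ?_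
        rw [restoreVertex_mk_eq_iff] at h1
        exact ConnectedComponent.eq.2 ((deletionLabel_eq_iff hi hj).1 (h i hi j hj h1))
    obtain ⟨s, hs, h⟩ := key
    have := ih (S.erase s) (by rw [Finset.card_erase_of_mem hs, hn]; rfl)
    omega

theorem exists_cutVertex (hG : G.Connected) (htop : G ≠ ⊤)
    (hT : IsSerreS 2 (MvPolynomial (V ⊕ V) K ⧸ G.binomialEdgeIdeal K)) :
    ∃ v : V, 2 ≤ G.componentsAfterDeletion {v} := by
  classical
  let sep : Finset V → Prop := fun S =>
    ∃ i ∉ S, ∃ j ∉ S, G.deletionLabel S i ≠ G.deletionLabel S j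
  have hempty : ¬ sep ∅ := by
    rintro ⟨u, hu, v, hv, h⟩
    obtain ⟨w⟩ := hG.preconnected u v
    exact h ((deletionLabel_eq_iff hu hv).2
      ⟨w.map (⟨fun v => ⟨v, by simp⟩, fun h => by simpa using h⟩ :
        G →g G.induce ((∅ : Finset V) : Set V)ᶜ)⟩)
  have hex : ∃ S, sep S := by
    obtain ⟨i, j, hij, hadj⟩ : ∃ i j, i ≠ j ∧ ¬ G.Adj i j := by
      by_contra! h
      exact htop (by ext i j; exact ⟨fun h => h.ne, fun hne => h i j hne⟩)
    -- Only two nonadjacent vertices remain.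
    refine ⟨{i, j}ᶜ, i, by simp, j, by simp, fun h => ?_⟩
    rw [deletionLabel_eq_iff (by simp) (by simp)] at h
    obtain ⟨w⟩ := h
    cases w with
    | nil => exact hij rfl
    | @cons _ v _ h w =>
      have hv : (v : V) = i ∨ (v : V) = j := by
        by_contra! hv
        exact v.2 (by simpa using hv.symm)
      have h' : G.Adj i v := h
      rcases hv with hv | hv
      · exact h'.ne hv.symm
      · exact hadj (hv ▸ h')
  obtain ⟨S, hS, hmin⟩ : ∃ S, sep S ∧ ∀ T, T.card < S.card → ¬ sep T := by
    obtain ⟨S, hS, hmin⟩ := Finset.exists_min_image (Finset.univ.filter sep) Finset.card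
      (hex.imp fun S hS => by simpa using hS)
    exact ⟨S, by simpa using hS, fun T hT hsep => hT.not_ge (hmin T (by simpa using hsep))⟩
  have hne : S.Nonempty := by
    rw [Finset.nonempty_iff_ne_empty]
    rintro rfl
    exact hempty hS
  have hconst : ∀ s ∈ S, ∀ i ∉ S, ∀ j ∉ S,
      G.deletionLabel (S.erase s) i = G.deletionLabel (S.erase s) j := by
    intro s hs i hi j hj
    by_contra h
    exact hmin _ (Finset.card_erase_lt_of_mem hs) ⟨i, fun h => hi (Finset.mem_of_mem_erase h),
      j, fun h => hj (Finset.mem_of_mem_erase h), h⟩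
  obtain ⟨i, hi, j, hj, hij⟩ := hS
  obtain ⟨s, hs, hchain⟩ := exists_mem_not_chain hT hne
    fun s hs => ⟨i, hi, j, hj, hconst s hs i hi j hj, hij⟩
  have hSs : S = {s} := by
    by_contra hSs
    -- Restoring any vertex of the minimal S connects everything outside S, so q consists of
    -- rank-one conditions and vanishing on S. Vanishing on s alone lies strictly between.
    refine hchain (parallelIdeal K ∅ fun _ : V => ()) (parallelIdeal K {s} fun _ : V => ())
      inferInstance inferInstance (binomialEdgeIdeal_le_parallelIdeal fun _ _ _ _ _ => rfl)
      (lt_of_le_not_ge ?_ ?_) (lt_of_le_not_ge ?_ ?_)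
    · exact parallelIdeal_le_parallelIdeal_iff.2 ⟨by simp, by simp⟩
    · intro h
      simpa using (parallelIdeal_le_parallelIdeal_iff.1 h).1
    · exact parallelIdeal_le_parallelIdeal_iff.2
        ⟨by simpa using hs, fun i hi j hj _ => hconst s hs i hi j hj⟩
    · intro h
      exact hSs (((parallelIdeal_le_parallelIdeal_iff.1 h).1).antisymm (by simpa using hs))
  subst hSs
  refine ⟨s, ?_⟩
  have : Nontrivial (G.induce (({s} : Finset V) : Set V)ᶜ).ConnectedComponent :=
    ⟨_, _, (connectedComponentMk_ne_iff hi hj).2 hij⟩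
  exact Finite.one_lt_card_iff_nontrivial.2 this

/-! ### Toughness -/

theorem eq_top_or_toughness_eq_half (hG : G.Connected)
    (hT : IsSerreS 2 (MvPolynomial (V ⊕ V) K ⧸ G.binomialEdgeIdeal K)) :
    G = ⊤ ∨ G.toughness = 1 / 2 := by
  refine or_iff_not_imp_left.2 fun htop => le_antisymm ?_ ?_
  · obtain ⟨v, hv⟩ := exists_cutVertex hG htop hT
    refine iSup_le fun ⟨t, ht⟩ => ?_
    have h1 := ht.2 {v} (by simp) hv
    have h2 : t * 2 ≤ 1 := by
      refine le_trans (mul_le_mul_right (by exact_mod_cast hv) t) (h1.trans ?_)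
      simp
    rw [ENNReal.le_div_iff_mul_le (by simp) (by simp)]
    exact_mod_cast h2
  · have htough : G.IsTough (1 / 2) := by
      refine ⟨hG, fun S hne _ => ?_⟩
      have h1 := componentsAfterDeletion_le_card_add_one hG hT S
      have h2 : G.componentsAfterDeletion S ≤ 2 * S.card := by
        have := hne.card_pos
        omega
      have h3 : (G.componentsAfterDeletion S : ℝ≥0) ≤ 2 * (S.card : ℝ≥0) := by exact_mod_cast h2
      calc (1 / 2 : ℝ≥0) * G.componentsAfterDeletion S ≤ 1 / 2 * (2 * (S.card : ℝ≥0)) := by gcongr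
        _ = S.card := by rw [← mul_assoc]; norm_num
    refine le_trans ?_ (le_iSup (fun t : {t : ℝ≥0 // G.IsTough t} => (t.1 : ℝ≥0∞)) ⟨_, htough⟩)
    simp

end SimpleGraph

theorem theoremA {K : Type*} [Field K] (n : ℕ) (G : SimpleGraph (Fin n)) (hG : G.Connected) :
    (IsSerreS 2 (MvPolynomial (Fin n ⊕ Fin n) K ⧸ G.binomialEdgeIdeal K) →
      G = ⊤ ∨ G.toughness = 1 / 2) ∧
    (IsCohenMacaulay (MvPolynomial (Fin n ⊕ Fin n) K ⧸ G.binomialEdgeIdeal K) →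
      G = ⊤ ∨ G.toughness = 1 / 2) :=
  ⟨SimpleGraph.eq_top_or_toughness_eq_half hG,
    fun h => SimpleGraph.eq_top_or_toughness_eq_half hG (h.isSerreS 2)⟩
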